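/- Let $q$ be a nonzero complex number that is not a root of unity (in particular $q\neq\pm1$), and fix a logarithm $\ln q$ of $q$. Let $U=U_q(\mathfrak{sl}_2)$ be the unital associative $\mathbb{C}$-algebra generated by $E,F,K,K^{-1}$ with relations $$KK^{-1}=K^{-1}K=1,\quad KE=q^2EK,\quad KF=q^{-2}FK,\quad EF-FE=\frac{K-K^{-1}}{q-q^{-1}},$$ with coproduct $\triangle(K^{\pm1})=K^{\pm1}\otimes K^{\pm1}$, $\triangle(E)=E\otimes K+1\otimes E$, $\triangle(F)=F\otimes 1+K^{-1}\otimes F$ and antipode $S(K^{\pm1})=K^{\mp1}$, $S(E)=-EK^{-1}$, $S(F)=-KF$. Adjoin an element $H$ with $[H,E]=2E$, $[H,F]=-2F$, $[H,K]=0$, $\triangle(H)=H\otimes1+1\otimes H$, $S(H)=-H$. We regard $U$ and $H$ inside the completion $\prod_{m\ge0}\mathrm{End}(V_m)$, and $U\otimes U$ inside $\prod_{m,n\ge0}\mathrm{End}(V_m\otimes V_n)$, with the product topologies, where $V_m$ is the simple $(m+1)$-dimensional $U$-module on which $K$ has eigenvalues $q^{m},q^{m-2},\dots,q^{-m}$,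 and $H$ acts on the $q^{k}$-eigenvector of $K$ ($k=m,m-2,\dots,-m$) by $k$, so that $K=q^{H}$. Let $$R=\sum R_1\otimes R_2=\sum_{n=0}^\infty\sum_{l=0}^\infty\Big(\frac{\ln q}{2}\Big)^l\frac{1}{l!}\,q^{\frac{n(n+1)}{2}}\frac{(1-q^{-2})^n}{[n]_q!}\,H^lE^n\otimes H^lF^n,$$ where $[n]_q=\frac{q^n-q^{-n}}{q-q^{-1}}$, $[n]_q!=[n]_q[n-1]_q\cdots[1]_q$ and $[0]_q!=1$. Write $b\triangleright a=\sum b_{(1)}\,a\,S(b_{(2)})$ for the left adjoint action, and define the braided coproduct and the braided antipode of $a\in U$ by $$\underline{\triangle}(a)=\sum a_{(1)}S(R_2)\otimes (R_1\triangleright a_{(2)}),\qquad \underline{S}(a)=\sum R_2\,S(R_1\triangleright a)$$ (series in the completions). Let $$Cas_q=EF+\frac{qK^{-1}+q^{-1}K}{(q-q^{-1})^2}.$$ Then the series defining $\underline{\triangle}(Cas_q)$ and $\underline{S}(Cas_q)$ converge, and $$\underline{\triangle}(Cas_q)=E\otimes KF+q^{-2}KF\otimes E+q^{-1}(q-q^{-1})^2\,Cas_q\otimes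 Cas_q-q^{-2}\,Cas_q\otimes K-q^{-2}K\otimes Cas_q+q^{-2}\frac{q+q^{-1}}{(q-q^{-1})^2}\,K\otimes K,$$ $$\underline{S}(Cas_q)=Cas_q.$$ -/

import Mathlib

open scoped TensorProduct

noncomputable section

namespace QuantumSL2

/-! ### The Hopf algebra `U_q(sl_2)` -/

/-- The generators `E, F, K, K⁻¹` of `U_q(sl_2)`. -/
inductive Gen : Type
  | E | F | K | Kinv

/-- The defining relations of `U_q(sl_2)`. -/
inductive Rel (q : ℂˣ) : FreeAlgebra ℂ Gen → FreeAlgebra ℂ Gen → Prop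
  | K_mul_Kinv : Rel q (FreeAlgebra.ι ℂ Gen.K * FreeAlgebra.ι ℂ Gen.Kinv) 1
  | Kinv_mul_K : Rel q (FreeAlgebra.ι ℂ Gen.Kinv * FreeAlgebra.ι ℂ Gen.K) 1
  | K_mul_E : Rel q (FreeAlgebra.ι ℂ Gen.K * FreeAlgebra.ι ℂ Gen.E)
      ((q : ℂ) ^ 2 • (FreeAlgebra.ι ℂ Gen.E * FreeAlgebra.ι ℂ Gen.K))
  | K_mul_F : Rel q (FreeAlgebra.ι ℂ Gen.K * FreeAlgebra.ι ℂ Gen.F)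
      (((q : ℂ) ^ 2)⁻¹ • (FreeAlgebra.ι ℂ Gen.F * FreeAlgebra.ι ℂ Gen.K))
  | E_F : Rel q (FreeAlgebra.ι ℂ Gen.E * FreeAlgebra.ι ℂ Gen.F
        - FreeAlgebra.ι ℂ Gen.F * FreeAlgebra.ι ℂ Gen.E)
      (((q : ℂ) - (q : ℂ)⁻¹)⁻¹ • (FreeAlgebra.ι ℂ Gen.K - FreeAlgebra.ι ℂ Gen.Kinv))

/-- The quantum algebra `U_q(sl_2)` over `ℂ`. -/
def Uq (q : ℂˣ) : Type := RingQuot (Rel q)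

instance (q : ℂˣ) : Ring (Uq q) := inferInstanceAs (Ring (RingQuot (Rel q)))

instance (q : ℂˣ) : Algebra ℂ (Uq q) := inferInstanceAs (Algebra ℂ (RingQuot (Rel q)))

/-! Verification of the relations for the images of the generators under coproduct and antipode. -/

section Relations

variable {A : Type} [Ring A] [Algebra ℂ A] (q : ℂˣ) {e f k k' : A}

theorem comul_K_mul_E (h3 : k * e = (q : ℂ) ^ 2 • (e * k)) :
    (k ⊗ₜ[ℂ] k) * (e ⊗ₜ[ℂ] k + 1 ⊗ₜ[ℂ] e)
      = (q : ℂ) ^ 2 • ((e ⊗ₜ[ℂ] k + 1 ⊗ₜ[ℂ] e) * (k ⊗ₜ[ℂ] k)) := by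
  simp only [mul_add, add_mul, Algebra.TensorProduct.tmul_mul_tmul, mul_one, one_mul, h3,
    TensorProduct.tmul_smul, ← TensorProduct.smul_tmul', smul_add]

theorem comul_K_mul_F (h1 : k * k' = 1) (h2 : k' * k = 1)
    (h4 : k * f = ((q : ℂ) ^ 2)⁻¹ • (f * k)) :
    (k ⊗ₜ[ℂ] k) * (f ⊗ₜ[ℂ] 1 + k' ⊗ₜ[ℂ] f)
      = ((q : ℂ) ^ 2)⁻¹ • ((f ⊗ₜ[ℂ] 1 + k' ⊗ₜ[ℂ] f) * (k ⊗ₜ[ℂ] k)) := by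
  simp only [mul_add, add_mul, Algebra.TensorProduct.tmul_mul_tmul, mul_one, one_mul, h4, h1, h2,
    TensorProduct.tmul_smul, ← TensorProduct.smul_tmul', smul_add]

theorem kinv_mul_e (h1 : k * k' = 1) (h2 : k' * k = 1) (h3 : k * e = (q : ℂ) ^ 2 • (e * k)) :
    e * k' = (q : ℂ) ^ 2 • (k' * e) := by
  have h : k' * (k * e) * k' = (q : ℂ) ^ 2 • (k' * (e * k) * k') := by
    rw [h3, mul_smul_comm, smul_mul_assoc]
  rwa [← mul_assoc, h2, one_mul, ← mul_assoc, mul_assoc (k' * e), h1, mul_one] at h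

theorem kinv_mul_f (h1 : k * k' = 1) (h2 : k' * k = 1)
    (h4 : k * f = ((q : ℂ) ^ 2)⁻¹ • (f * k)) :
    f * k' = ((q : ℂ) ^ 2)⁻¹ • (k' * f) := by
  have h : k' * (k * f) * k' = ((q : ℂ) ^ 2)⁻¹ • (k' * (f * k) * k') := by
    rw [h4, mul_smul_comm, smul_mul_assoc]
  rwa [← mul_assoc, h2, one_mul, ← mul_assoc, mul_assoc (k' * f), h1, mul_one] at h

theorem comul_E_F (h1 : k * k' = 1) (h2 : k' * k = 1)
    (h3 : k * e = (q : ℂ) ^ 2 • (e * k)) (h4 : k * f = ((q : ℂ) ^ 2)⁻¹ • (f * k))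
    (h5 : e * f - f * e = ((q : ℂ) - (q : ℂ)⁻¹)⁻¹ • (k - k')) :
    (e ⊗ₜ[ℂ] k + 1 ⊗ₜ[ℂ] e) * (f ⊗ₜ[ℂ] 1 + k' ⊗ₜ[ℂ] f)
      - (f ⊗ₜ[ℂ] 1 + k' ⊗ₜ[ℂ] f) * (e ⊗ₜ[ℂ] k + 1 ⊗ₜ[ℂ] e)
      = ((q : ℂ) - (q : ℂ)⁻¹)⁻¹ • (k ⊗ₜ[ℂ] k - k' ⊗ₜ[ℂ] k') := by
  have hq : (q : ℂ) ^ 2 ≠ 0 := pow_ne_zero _ q.ne_zero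
  have h6 := kinv_mul_e q h1 h2 h3
  have h7 : (e * k') ⊗ₜ[ℂ] (k * f) = (k' * e) ⊗ₜ[ℂ] (f * k) := by
    rw [h6, h4, TensorProduct.tmul_smul, ← TensorProduct.smul_tmul', smul_smul,
      inv_mul_cancel₀ hq, one_smul]
  have h8 : (e ⊗ₜ[ℂ] k + 1 ⊗ₜ[ℂ] e) * (f ⊗ₜ[ℂ] 1 + k' ⊗ₜ[ℂ] f)
      - (f ⊗ₜ[ℂ] 1 + k' ⊗ₜ[ℂ] f) * (e ⊗ₜ[ℂ] k + 1 ⊗ₜ[ℂ] e)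
      = (e * f - f * e) ⊗ₜ[ℂ] k + k' ⊗ₜ[ℂ] (e * f - f * e) := by
    simp only [mul_add, add_mul, Algebra.TensorProduct.tmul_mul_tmul, mul_one, one_mul, h7,
      TensorProduct.sub_tmul, TensorProduct.tmul_sub]
    abel
  rw [h8, h5, TensorProduct.tmul_smul, ← TensorProduct.smul_tmul', ← smul_add,
    TensorProduct.sub_tmul, TensorProduct.tmul_sub]
  congr 1
  abel

theorem antipode_E_F (h1 : k * k' = 1) (h2 : k' * k = 1)
    (h3 : k * e = (q : ℂ) ^ 2 • (e * k)) (h4 : k * f = ((q : ℂ) ^ 2)⁻¹ • (f * k))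
    (h5 : e * f - f * e = ((q : ℂ) - (q : ℂ)⁻¹)⁻¹ • (k - k')) :
    (k * f) * (e * k') - (e * k') * (k * f) = ((q : ℂ) - (q : ℂ)⁻¹)⁻¹ • (k' - k) := by
  have hq : (q : ℂ) ^ 2 ≠ 0 := pow_ne_zero _ q.ne_zero
  have h6 := kinv_mul_e q h1 h2 h3
  have h8 : (e * k') * (k * f) = e * f := by
    rw [mul_assoc, ← mul_assoc k', h2, one_mul]
  have h9 : (k * f) * (e * k') = f * e := by
    rw [h4, h6, smul_mul_smul_comm, inv_mul_cancel₀ hq, one_smul, mul_assoc, ← mul_assoc k, h1,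
      one_mul]
  rw [h8, h9, ← neg_sub, h5, ← smul_neg, neg_sub]

end Relations

namespace Uq

/-- The class of a generator in `U_q(sl_2)`. -/
def gen (q : ℂˣ) (g : Gen) : Uq q := RingQuot.mkAlgHom ℂ (Rel q) (FreeAlgebra.ι ℂ g)

abbrev E (q : ℂˣ) : Uq q := gen q Gen.E
abbrev F (q : ℂˣ) : Uq q := gen q Gen.F
abbrev K (q : ℂˣ) : Uq q := gen q Gen.K
abbrev Kinv (q : ℂˣ) : Uq q := gen q Gen.Kinv

theorem K_mul_Kinv (q : ℂˣ) : K q * Kinv q = 1 := by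
  have h := RingQuot.mkAlgHom_rel ℂ (Rel.K_mul_Kinv (q := q))
  rwa [map_mul, map_one] at h

theorem Kinv_mul_K (q : ℂˣ) : Kinv q * K q = 1 := by
  have h := RingQuot.mkAlgHom_rel ℂ (Rel.Kinv_mul_K (q := q))
  rwa [map_mul, map_one] at h

theorem K_mul_E (q : ℂˣ) : K q * E q = (q : ℂ) ^ 2 • (E q * K q) := by
  have h := RingQuot.mkAlgHom_rel ℂ (Rel.K_mul_E (q := q))
  rwa [map_mul, map_smul, map_mul] at h

theorem K_mul_F (q : ℂˣ) : K q * F q = ((q : ℂ) ^ 2)⁻¹ • (F q * K q) := by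
  have h := RingQuot.mkAlgHom_rel ℂ (Rel.K_mul_F (q := q))
  rwa [map_mul, map_smul, map_mul] at h

theorem E_F (q : ℂˣ) :
    E q * F q - F q * E q = ((q : ℂ) - (q : ℂ)⁻¹)⁻¹ • (K q - Kinv q) := by
  have h := RingQuot.mkAlgHom_rel ℂ (Rel.E_F (q := q))
  rwa [map_sub, map_mul, map_mul, map_smul, map_sub] at h

/-- The universal property of `U_q(sl_2)`: an algebra homomorphism is given by the images
`e, f, k, k'` of `E, F, K, K⁻¹`, subject to the defining relations. -/
def lift (q : ℂˣ) {A : Type} [Ring A] [Algebra ℂ A] (e f k k' : A)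
    (h1 : k * k' = 1) (h2 : k' * k = 1) (h3 : k * e = (q : ℂ) ^ 2 • (e * k))
    (h4 : k * f = ((q : ℂ) ^ 2)⁻¹ • (f * k))
    (h5 : e * f - f * e = ((q : ℂ) - (q : ℂ)⁻¹)⁻¹ • (k - k')) : Uq q →ₐ[ℂ] A :=
  RingQuot.liftAlgHom ℂ
    ⟨FreeAlgebra.lift ℂ (fun g => match g with
      | Gen.E => e | Gen.F => f | Gen.K => k | Gen.Kinv => k'), by
      rintro _ _ (_ | _ | _ | _ | _) <;> simp [*]⟩

/-- The coproduct of `U_q(sl_2)`: `Δ(K^{±1}) = K^{±1} ⊗ K^{±1}`, `Δ(E) = E ⊗ K + 1 ⊗ E`,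
`Δ(F) = F ⊗ 1 + K⁻¹ ⊗ F`. -/
def comul (q : ℂˣ) : Uq q →ₐ[ℂ] Uq q ⊗[ℂ] Uq q :=
  lift q (E q ⊗ₜ K q + 1 ⊗ₜ E q) (F q ⊗ₜ 1 + Kinv q ⊗ₜ F q) (K q ⊗ₜ K q) (Kinv q ⊗ₜ Kinv q)
    (by simp [K_mul_Kinv, Algebra.TensorProduct.one_def])
    (by simp [Kinv_mul_K, Algebra.TensorProduct.one_def])
    (comul_K_mul_E q (K_mul_E q))
    (comul_K_mul_F q (K_mul_Kinv q) (Kinv_mul_K q) (K_mul_F q))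
    (comul_E_F q (K_mul_Kinv q) (Kinv_mul_K q) (K_mul_E q) (K_mul_F q) (E_F q))

/-- The quantum Casimir element `Cas_q = E F + (q K⁻¹ + q⁻¹ K) / (q - q⁻¹)²`. -/
def Cas (q : ℂˣ) : Uq q :=
  E q * F q + (((q : ℂ) - (q : ℂ)⁻¹) ^ 2)⁻¹ • ((q : ℂ) • Kinv q + (q : ℂ)⁻¹ • K q)

end Uq

/-! ### Adjoining the Cartan element `H` -/

/-- The generators `E, F, K, K⁻¹, H`. -/
inductive GenH : Type
  | E | F | K | Kinv | H

/-- The relations of `U_q(sl_2)` together with `[H, E] = 2E`, `[H, F] = -2F`, `[H, K] = 0`. -/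
inductive RelH (q : ℂˣ) : FreeAlgebra ℂ GenH → FreeAlgebra ℂ GenH → Prop
  | K_mul_Kinv : RelH q (FreeAlgebra.ι ℂ GenH.K * FreeAlgebra.ι ℂ GenH.Kinv) 1
  | Kinv_mul_K : RelH q (FreeAlgebra.ι ℂ GenH.Kinv * FreeAlgebra.ι ℂ GenH.K) 1
  | K_mul_E : RelH q (FreeAlgebra.ι ℂ GenH.K * FreeAlgebra.ι ℂ GenH.E)
      ((q : ℂ) ^ 2 • (FreeAlgebra.ι ℂ GenH.E * FreeAlgebra.ι ℂ GenH.K))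
  | K_mul_F : RelH q (FreeAlgebra.ι ℂ GenH.K * FreeAlgebra.ι ℂ GenH.F)
      (((q : ℂ) ^ 2)⁻¹ • (FreeAlgebra.ι ℂ GenH.F * FreeAlgebra.ι ℂ GenH.K))
  | E_F : RelH q (FreeAlgebra.ι ℂ GenH.E * FreeAlgebra.ι ℂ GenH.F
        - FreeAlgebra.ι ℂ GenH.F * FreeAlgebra.ι ℂ GenH.E)
      (((q : ℂ) - (q : ℂ)⁻¹)⁻¹ • (FreeAlgebra.ι ℂ GenH.K - FreeAlgebra.ι ℂ GenH.Kinv))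
  | H_E : RelH q (FreeAlgebra.ι ℂ GenH.H * FreeAlgebra.ι ℂ GenH.E
        - FreeAlgebra.ι ℂ GenH.E * FreeAlgebra.ι ℂ GenH.H)
      ((2 : ℂ) • FreeAlgebra.ι ℂ GenH.E)
  | H_F : RelH q (FreeAlgebra.ι ℂ GenH.H * FreeAlgebra.ι ℂ GenH.F
        - FreeAlgebra.ι ℂ GenH.F * FreeAlgebra.ι ℂ GenH.H)
      ((-2 : ℂ) • FreeAlgebra.ι ℂ GenH.F)
  | H_K : RelH q (FreeAlgebra.ι ℂ GenH.H * FreeAlgebra.ι ℂ GenH.K)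
      (FreeAlgebra.ι ℂ GenH.K * FreeAlgebra.ι ℂ GenH.H)

/-- The algebra `U_q(sl_2)` with an element `H` adjoined. The identity `K = q^H` is not imposed
here; it holds in the completion introduced below. -/
def UqH (q : ℂˣ) : Type := RingQuot (RelH q)

instance (q : ℂˣ) : Ring (UqH q) := inferInstanceAs (Ring (RingQuot (RelH q)))

instance (q : ℂˣ) : Algebra ℂ (UqH q) := inferInstanceAs (Algebra ℂ (RingQuot (RelH q)))

namespace UqH

/-- The class of a generator. -/
def gen (q : ℂˣ) (g : GenH) : UqH q := RingQuot.mkAlgHom ℂ (RelH q) (FreeAlgebra.ι ℂ g)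

abbrev E (q : ℂˣ) : UqH q := gen q GenH.E
abbrev F (q : ℂˣ) : UqH q := gen q GenH.F
abbrev K (q : ℂˣ) : UqH q := gen q GenH.K
abbrev Kinv (q : ℂˣ) : UqH q := gen q GenH.Kinv
abbrev H (q : ℂˣ) : UqH q := gen q GenH.H

theorem K_mul_Kinv (q : ℂˣ) : K q * Kinv q = 1 := by
  have h := RingQuot.mkAlgHom_rel ℂ (RelH.K_mul_Kinv (q := q))
  rwa [map_mul, map_one] at h

theorem Kinv_mul_K (q : ℂˣ) : Kinv q * K q = 1 := by
  have h := RingQuot.mkAlgHom_rel ℂ (RelH.Kinv_mul_K (q := q))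
  rwa [map_mul, map_one] at h

theorem K_mul_E (q : ℂˣ) : K q * E q = (q : ℂ) ^ 2 • (E q * K q) := by
  have h := RingQuot.mkAlgHom_rel ℂ (RelH.K_mul_E (q := q))
  rwa [map_mul, map_smul, map_mul] at h

theorem K_mul_F (q : ℂˣ) : K q * F q = ((q : ℂ) ^ 2)⁻¹ • (F q * K q) := by
  have h := RingQuot.mkAlgHom_rel ℂ (RelH.K_mul_F (q := q))
  rwa [map_mul, map_smul, map_mul] at h

theorem E_F (q : ℂˣ) :
    E q * F q - F q * E q = ((q : ℂ) - (q : ℂ)⁻¹)⁻¹ • (K q - Kinv q) := by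
  have h := RingQuot.mkAlgHom_rel ℂ (RelH.E_F (q := q))
  rwa [map_sub, map_mul, map_mul, map_smul, map_sub] at h

theorem H_E (q : ℂˣ) : H q * E q - E q * H q = (2 : ℂ) • E q := by
  have h := RingQuot.mkAlgHom_rel ℂ (RelH.H_E (q := q))
  rwa [map_sub, map_mul, map_mul, map_smul] at h

theorem H_F (q : ℂˣ) : H q * F q - F q * H q = (-2 : ℂ) • F q := by
  have h := RingQuot.mkAlgHom_rel ℂ (RelH.H_F (q := q))
  rwa [map_sub, map_mul, map_mul, map_smul] at h

theorem H_K (q : ℂˣ) : H q * K q = K q * H q := by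
  have h := RingQuot.mkAlgHom_rel ℂ (RelH.H_K (q := q))
  rwa [map_mul, map_mul] at h

theorem H_Kinv (q : ℂˣ) : H q * Kinv q = Kinv q * H q := by
  have h : Kinv q * (H q * K q) * Kinv q = Kinv q * (K q * H q) * Kinv q := by rw [H_K]
  rw [← mul_assoc, mul_assoc (Kinv q * H q), K_mul_Kinv, mul_one, ← mul_assoc, Kinv_mul_K,
    one_mul] at h
  exact h.symm

/-- The universal property of `UqH q`. -/
def lift (q : ℂˣ) {A : Type} [Ring A] [Algebra ℂ A] (e f k k' h : A)
    (h1 : k * k' = 1) (h2 : k' * k = 1) (h3 : k * e = (q : ℂ) ^ 2 • (e * k))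
    (h4 : k * f = ((q : ℂ) ^ 2)⁻¹ • (f * k))
    (h5 : e * f - f * e = ((q : ℂ) - (q : ℂ)⁻¹)⁻¹ • (k - k'))
    (h6 : h * e - e * h = (2 : ℂ) • e) (h7 : h * f - f * h = (-2 : ℂ) • f)
    (h8 : h * k = k * h) : UqH q →ₐ[ℂ] A :=
  RingQuot.liftAlgHom ℂ
    ⟨FreeAlgebra.lift ℂ (fun g => match g with
      | GenH.E => e | GenH.F => f | GenH.K => k | GenH.Kinv => k' | GenH.H => h), by
      rintro _ _ (_ | _ | _ | _ | _ | _ | _ | _) <;>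
        simp only [map_mul, map_sub, map_smul, map_one, FreeAlgebra.lift_ι_apply] <;> assumption⟩

/-- The canonical homomorphism from `U_q(sl_2)`. -/
def ofUq (q : ℂˣ) : Uq q →ₐ[ℂ] UqH q :=
  Uq.lift q (E q) (F q) (K q) (Kinv q) (K_mul_Kinv q) (Kinv_mul_K q) (K_mul_E q) (K_mul_F q) (E_F q)

/-- The coproduct: as on `U_q(sl_2)`, and `Δ(H) = H ⊗ 1 + 1 ⊗ H`. -/
def comul (q : ℂˣ) : UqH q →ₐ[ℂ] UqH q ⊗[ℂ] UqH q :=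
  lift q (E q ⊗ₜ K q + 1 ⊗ₜ E q) (F q ⊗ₜ 1 + Kinv q ⊗ₜ F q) (K q ⊗ₜ K q) (Kinv q ⊗ₜ Kinv q)
    (H q ⊗ₜ 1 + 1 ⊗ₜ H q)
    (by simp [K_mul_Kinv, Algebra.TensorProduct.one_def])
    (by simp [Kinv_mul_K, Algebra.TensorProduct.one_def])
    (comul_K_mul_E q (K_mul_E q))
    (comul_K_mul_F q (K_mul_Kinv q) (Kinv_mul_K q) (K_mul_F q))
    (comul_E_F q (K_mul_Kinv q) (Kinv_mul_K q) (K_mul_E q) (K_mul_F q) (E_F q))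
    (by
      have h : (H q ⊗ₜ[ℂ] 1 + 1 ⊗ₜ[ℂ] H q) * (E q ⊗ₜ[ℂ] K q + 1 ⊗ₜ[ℂ] E q)
          - (E q ⊗ₜ[ℂ] K q + 1 ⊗ₜ[ℂ] E q) * (H q ⊗ₜ[ℂ] 1 + 1 ⊗ₜ[ℂ] H q)
          = (H q * E q - E q * H q) ⊗ₜ[ℂ] K q + 1 ⊗ₜ[ℂ] (H q * E q - E q * H q) := by
        simp only [mul_add, add_mul, Algebra.TensorProduct.tmul_mul_tmul, mul_one, one_mul, H_K,
          TensorProduct.sub_tmul, TensorProduct.tmul_sub]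
        abel
      rw [h, H_E, TensorProduct.tmul_smul, ← TensorProduct.smul_tmul', ← smul_add])
    (by
      have h : (H q ⊗ₜ[ℂ] 1 + 1 ⊗ₜ[ℂ] H q) * (F q ⊗ₜ[ℂ] 1 + Kinv q ⊗ₜ[ℂ] F q)
          - (F q ⊗ₜ[ℂ] 1 + Kinv q ⊗ₜ[ℂ] F q) * (H q ⊗ₜ[ℂ] 1 + 1 ⊗ₜ[ℂ] H q)
          = (H q * F q - F q * H q) ⊗ₜ[ℂ] 1 + Kinv q ⊗ₜ[ℂ] (H q * F q - F q * H q) := by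
        simp only [mul_add, add_mul, Algebra.TensorProduct.tmul_mul_tmul, mul_one, one_mul, H_Kinv,
          TensorProduct.sub_tmul, TensorProduct.tmul_sub]
        abel
      rw [h, H_F, TensorProduct.tmul_smul, ← TensorProduct.smul_tmul', ← smul_add])
    (by
      simp only [mul_add, add_mul, Algebra.TensorProduct.tmul_mul_tmul, mul_one, one_mul, H_K])

/-- The antipode as a homomorphism to the opposite algebra: `S(K^{±1}) = K^{∓1}`,
`S(E) = -E K⁻¹`, `S(F) = -K F`, `S(H) = -H`. -/
def antipodeOp (q : ℂˣ) : UqH q →ₐ[ℂ] (UqH q)ᵐᵒᵖ :=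
  lift q (MulOpposite.op (-(E q * Kinv q))) (MulOpposite.op (-(K q * F q)))
    (MulOpposite.op (Kinv q)) (MulOpposite.op (K q)) (MulOpposite.op (-H q))
    (by rw [← MulOpposite.op_mul, K_mul_Kinv, MulOpposite.op_one])
    (by rw [← MulOpposite.op_mul, Kinv_mul_K, MulOpposite.op_one])
    (by
      rw [← MulOpposite.op_mul, ← MulOpposite.op_mul, ← MulOpposite.op_smul]
      have h := kinv_mul_e q (K_mul_Kinv q) (Kinv_mul_K q) (K_mul_E q)
      congr 1
      rw [neg_mul, mul_neg, smul_neg, ← mul_assoc (Kinv q), ← smul_mul_assoc, ← h])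
    (by
      rw [← MulOpposite.op_mul, ← MulOpposite.op_mul, ← MulOpposite.op_smul]
      have h := kinv_mul_f q (K_mul_Kinv q) (Kinv_mul_K q) (K_mul_F q)
      congr 1
      rw [neg_mul, mul_neg, smul_neg, mul_assoc, h, mul_smul_comm, ← mul_assoc, ← mul_assoc,
        K_mul_Kinv, Kinv_mul_K])
    (by
      rw [← MulOpposite.op_mul, ← MulOpposite.op_mul, ← MulOpposite.op_sub,
        ← MulOpposite.op_sub, ← MulOpposite.op_smul, neg_mul_neg, neg_mul_neg,
        antipode_E_F q (K_mul_Kinv q) (Kinv_mul_K q) (K_mul_E q) (K_mul_F q) (E_F q)])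
    (by
      rw [← MulOpposite.op_mul, ← MulOpposite.op_mul, ← MulOpposite.op_sub,
        ← MulOpposite.op_smul, neg_mul_neg, neg_mul_neg, mul_assoc, ← H_Kinv, ← mul_assoc,
        ← mul_assoc, ← sub_mul, ← neg_sub, H_E, neg_mul, smul_mul_assoc, smul_neg])
    (by
      rw [← MulOpposite.op_mul, ← MulOpposite.op_mul, ← MulOpposite.op_sub,
        ← MulOpposite.op_smul, neg_mul_neg, neg_mul_neg, ← mul_assoc, H_K, mul_assoc, mul_assoc,
        ← mul_sub, ← neg_sub, H_F, mul_neg, mul_smul_comm, smul_neg])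
    (by
      rw [← MulOpposite.op_mul, ← MulOpposite.op_mul, mul_neg, neg_mul, H_Kinv])

/-- The antipode `S`, an algebra anti-homomorphism. -/
def antipode (q : ℂˣ) : UqH q →ₗ[ℂ] UqH q :=
  (MulOpposite.opLinearEquiv ℂ).symm.toLinearMap ∘ₗ (antipodeOp q).toLinearMap

/-- The left adjoint action `b ▷ a = ad_b(a) = ∑ b₍₁₎ a S(b₍₂₎)`, linear in `b` and in `a`. -/
def ad (q : ℂˣ) : UqH q →ₗ[ℂ] UqH q →ₗ[ℂ] UqH q :=
  TensorProduct.lift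
    ((LinearMap.mul ℂ (Module.End ℂ (UqH q))).compl₁₂ (LinearMap.mul ℂ (UqH q))
      ((LinearMap.mul ℂ (UqH q)).flip ∘ₗ antipode q)) ∘ₗ (comul q).toLinearMap

end UqH

/-! ### The completion

The completion of `U_q(sl_2)` is the algebra `∏_m End(V_m)`, where `V_m` (`m = 0, 1, 2, …`) are the
simple `U_q(sl_2)`-modules of dimension `m + 1` on which `K` has eigenvalues
`q^m, q^(m-2), …, q^(-m)`; the completion of `U_q(sl_2) ⊗ U_q(sl_2)` is `∏_{m,n} End(V_m ⊗ V_n)`.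
Both carry the product topology. -/

/-- The `q`-number `[n]_q = (q^n - q^(-n)) / (q - q⁻¹)`. -/
def qNumber (q : ℂˣ) (n : ℤ) : ℂ := ((q : ℂ) ^ n - (q : ℂ) ^ (-n)) / ((q : ℂ) - (q : ℂ)⁻¹)

/-- The `q`-factorial `[n]_q! = [1]_q [2]_q ⋯ [n]_q`. -/
def qFactorial (q : ℂˣ) (n : ℕ) : ℂ := ∏ i ∈ Finset.range n, qNumber q (i + 1)

/-- `E v_j = [j]_q [m - j + 1]_q v_{j-1}` on `V_m`. -/
def matE (q : ℂˣ) (m : ℕ) : Matrix (Fin (m + 1)) (Fin (m + 1)) ℂ :=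
  Matrix.of fun i j => if (i : ℕ) + 1 = j then qNumber q (j : ℕ) * qNumber q (m - (j : ℕ) + 1) else 0

/-- `F v_j = v_{j+1}` on `V_m`, with `F v_m = 0`. -/
def matF (m : ℕ) : Matrix (Fin (m + 1)) (Fin (m + 1)) ℂ :=
  Matrix.of fun i j => if (i : ℕ) = j + 1 then 1 else 0

/-- `K v_j = q^(m - 2j) v_j` on `V_m`. -/
def matK (q : ℂˣ) (m : ℕ) : Matrix (Fin (m + 1)) (Fin (m + 1)) ℂ :=
  Matrix.diagonal fun j => (q : ℂ) ^ ((m : ℤ) - 2 * (j : ℕ))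

/-- `K⁻¹ v_j = q^(-(m - 2j)) v_j` on `V_m`. -/
def matKinv (q : ℂˣ) (m : ℕ) : Matrix (Fin (m + 1)) (Fin (m + 1)) ℂ :=
  Matrix.diagonal fun j => (q : ℂ) ^ (-((m : ℤ) - 2 * (j : ℕ)))

/-- `H v_j = (m - 2j) v_j` on `V_m`, so that `K = q^H`. -/
def matH (m : ℕ) : Matrix (Fin (m + 1)) (Fin (m + 1)) ℂ :=
  Matrix.diagonal fun j => (((m : ℤ) - 2 * (j : ℕ) : ℤ) : ℂ)

theorem matK_mul_matE (q : ℂˣ) (m : ℕ) :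
    matK q m * matE q m = (q : ℂ) ^ 2 • (matE q m * matK q m) := by
  have hq := q.ne_zero
  ext i j
  simp only [matK, matE, Matrix.diagonal_mul, Matrix.smul_apply, Matrix.mul_diagonal,
    Matrix.of_apply, smul_eq_mul]
  split_ifs with h
  · have : ((m : ℤ) - 2 * (i : ℕ)) = 2 + ((m : ℤ) - 2 * (j : ℕ)) := by omega
    rw [this, zpow_add₀ hq, zpow_ofNat]
    ring
  · simp

theorem matK_mul_matF (q : ℂˣ) (m : ℕ) :
    matK q m * matF m = ((q : ℂ) ^ 2)⁻¹ • (matF m * matK q m) := by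
  have hq := q.ne_zero
  ext i j
  simp only [matK, matF, Matrix.diagonal_mul, Matrix.smul_apply, Matrix.mul_diagonal,
    Matrix.of_apply, smul_eq_mul]
  split_ifs with h
  · have : ((m : ℤ) - 2 * (i : ℕ)) = -2 + ((m : ℤ) - 2 * (j : ℕ)) := by omega
    rw [this, zpow_add₀ hq, zpow_neg, zpow_ofNat]
    ring
  · simp

theorem matE_matF (q : ℂˣ) (m : ℕ) :
    matE q m * matF m - matF m * matE q m
      = ((q : ℂ) - (q : ℂ)⁻¹)⁻¹ • (matK q m - matKinv q m) := by
  have hz : qNumber q 0 = 0 := by simp [qNumber]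
  have hEF : matE q m * matF m = Matrix.diagonal fun j : Fin (m + 1) =>
      qNumber q ((j : ℕ) + 1) * qNumber q (m - (j : ℕ)) := by
    ext i j
    rw [Matrix.mul_apply, Matrix.diagonal_apply]
    simp only [matE, matF, Matrix.of_apply]
    by_cases hj : (j : ℕ) + 1 < m + 1
    · rw [Finset.sum_eq_single (⟨(j : ℕ) + 1, hj⟩ : Fin (m + 1))]
      · by_cases hij : i = j
        · subst hij
          have h1 : (m : ℤ) - ((i : ℕ) + 1) + 1 = m - (i : ℕ) := by ring
          simp [h1]
        · have : ¬ ((i : ℕ) = j) := fun h => hij (Fin.ext h)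
          simp [hij, this]
      · intro k _ hk
        have : ¬ ((k : ℕ) = j + 1) := fun h => hk (Fin.ext h)
        simp [this]
      · simp
    · have hm : ((m : ℤ) - (j : ℕ)) = 0 := by omega
      rw [Finset.sum_eq_zero]
      · by_cases hij : i = j
        · subst hij
          simp [hm, hz]
        · simp [hij]
      · intro k _
        have : ¬ ((k : ℕ) = j + 1) := by omega
        simp [this]
  have hFE : matF m * matE q m = Matrix.diagonal fun j : Fin (m + 1) =>
      qNumber q (j : ℕ) * qNumber q (m - (j : ℕ) + 1) := by
    ext i j
    rw [Matrix.mul_apply, Matrix.diagonal_apply]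
    simp only [matE, matF, Matrix.of_apply]
    by_cases hj : (j : ℕ) = 0
    · rw [Finset.sum_eq_zero]
      · simp +contextual [hj, hz]
      · intro k _
        have : ¬ ((k : ℕ) + 1 = j) := by omega
        simp [this]
    · rw [Finset.sum_eq_single (⟨(j : ℕ) - 1, by omega⟩ : Fin (m + 1))]
      · have h1 : (j : ℕ) - 1 + 1 = j := by omega
        by_cases hij : i = j
        · subst hij
          simp [h1]
        · have : ¬ ((i : ℕ) = j) := fun h => hij (Fin.ext h)
          simp [h1, hij, this]
      · intro k _ hk
        have : ¬ ((k : ℕ) + 1 = j) := fun h => hk (Fin.ext (by simp; omega))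
        simp [this]
      · simp
  rw [hEF, hFE, matK, matKinv, Matrix.diagonal_sub, Matrix.diagonal_sub, ← Matrix.diagonal_smul]
  congr 1
  ext j
  simp only [Pi.smul_apply, smul_eq_mul, qNumber]
  have hq := q.ne_zero
  by_cases hd : (q : ℂ) - (q : ℂ)⁻¹ = 0
  · simp [hd]
  · have e1 : (q : ℂ) ^ ((m : ℤ) - (j : ℕ)) = q ^ (m : ℤ) * ((q : ℂ) ^ ((j : ℕ) : ℤ))⁻¹ := by
      rw [zpow_sub₀ hq, div_eq_mul_inv]
    have e2 : (q : ℂ) ^ ((m : ℤ) - 2 * (j : ℕ))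
        = q ^ (m : ℤ) * (((q : ℂ) ^ ((j : ℕ) : ℤ))⁻¹) ^ 2 := by
      rw [zpow_sub₀ hq, div_eq_mul_inv, mul_comm (2 : ℤ), zpow_mul, zpow_ofNat, inv_pow]
    have hx : (q : ℂ) ^ (m : ℤ) ≠ 0 := zpow_ne_zero _ hq
    have hy : (q : ℂ) ^ ((j : ℕ) : ℤ) ≠ 0 := zpow_ne_zero _ hq
    simp only [zpow_neg, zpow_add₀ hq, zpow_one, e1, e2]
    generalize (q : ℂ) ^ (m : ℤ) = x at *
    generalize (q : ℂ) ^ ((j : ℕ) : ℤ) = y at *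
    generalize (q : ℂ) = z at *
    have hd' : z ^ 2 - 1 ≠ 0 := fun h => hd (by field_simp; simp [h])
    field_simp
    ring

/-- The representation of `UqH q` on `V_m`. -/
def rep (q : ℂˣ) (m : ℕ) : UqH q →ₐ[ℂ] Matrix (Fin (m + 1)) (Fin (m + 1)) ℂ :=
  UqH.lift q (matE q m) (matF m) (matK q m) (matKinv q m) (matH m)
    (by
      rw [matK, matKinv, Matrix.diagonal_mul_diagonal, ← Matrix.diagonal_one]
      congr 1
      ext j
      rw [← zpow_add₀ q.ne_zero, add_neg_cancel, zpow_zero])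
    (by
      rw [matK, matKinv, Matrix.diagonal_mul_diagonal, ← Matrix.diagonal_one]
      congr 1
      ext j
      rw [← zpow_add₀ q.ne_zero, neg_add_cancel, zpow_zero])
    (matK_mul_matE q m) (matK_mul_matF q m) (matE_matF q m)
    (by
      ext i j
      simp only [matH, matE, Matrix.diagonal_mul, Matrix.sub_apply, Matrix.smul_apply,
        Matrix.mul_diagonal, Matrix.of_apply, smul_eq_mul]
      split_ifs with h
      · rw [← h]
        push_cast
        ring
      · simp)
    (by
      ext i j
      simp only [matH, matF, Matrix.diagonal_mul, Matrix.sub_apply, Matrix.smul_apply,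
        Matrix.mul_diagonal, Matrix.of_apply, smul_eq_mul]
      split_ifs with h
      · rw [h]
        push_cast
        ring
      · simp)
    (by
      rw [matH, matK, Matrix.diagonal_mul_diagonal, Matrix.diagonal_mul_diagonal]
      congr 1
      ext j
      exact mul_comm _ _)

/-- The completion `∏_m End(V_m)` of `U_q(sl_2)`. -/
abbrev Completion : Type := (m : ℕ) → Matrix (Fin (m + 1)) (Fin (m + 1)) ℂ

/-- The completion `∏_{m,n} End(V_m ⊗ V_n)` of `U_q(sl_2) ⊗ U_q(sl_2)`. -/
abbrev Completion₂ : Type :=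
  (m n : ℕ) → Matrix (Fin (m + 1) × Fin (n + 1)) (Fin (m + 1) × Fin (n + 1)) ℂ

/-- The canonical map to the completion. -/
def toCompletion (q : ℂˣ) : UqH q →ₗ[ℂ] Completion :=
  LinearMap.pi fun m => (rep q m).toLinearMap

/-- The canonical map `x ⊗ y ↦ (ρ_m(x) ⊗ ρ_n(y))_{m,n}` of the tensor square to its completion. -/
def toCompletion₂ (q : ℂˣ) : UqH q ⊗[ℂ] UqH q →ₗ[ℂ] Completion₂ :=
  LinearMap.pi fun m => LinearMap.pi fun n =>
    TensorProduct.lift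
      ((Matrix.kroneckerBilinear (R := ℂ) (α := ℂ)).compl₁₂ (rep q m).toLinearMap (rep q n).toLinearMap)

/-- `U_q(sl_2)` in its completion. -/
def Uq.embed (q : ℂˣ) : Uq q →ₗ[ℂ] Completion :=
  toCompletion q ∘ₗ (UqH.ofUq q).toLinearMap

/-- `U_q(sl_2) ⊗ U_q(sl_2)` in its completion. -/
def Uq.embed₂ (q : ℂˣ) : Uq q ⊗[ℂ] Uq q →ₗ[ℂ] Completion₂ :=
  toCompletion₂ q ∘ₗ TensorProduct.map (UqH.ofUq q).toLinearMap (UqH.ofUq q).toLinearMap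

/-! ### The `R`-matrix, the braided coproduct and the braided antipode

`R = ∑_{l,n} c_{l,n} H^l E^n ⊗ H^l F^n` is a series of elements of `UqH q ⊗ UqH q`; below `h` stands
for a logarithm `ln(q)` of `q`, and the index is `p = (l, n)`. -/

/-- The coefficient `c_{l,n} = (ln(q)/2)^l / l! · q^(n(n+1)/2) (1 - q⁻²)^n / [n]_q!`. -/
def rCoeff (q : ℂˣ) (h : ℂ) (p : ℕ × ℕ) : ℂ :=
  (h / 2) ^ p.1 / (p.1.factorial : ℂ) *
    ((q : ℂ) ^ (p.2 * (p.2 + 1) / 2) * (1 - ((q : ℂ) ^ 2)⁻¹) ^ p.2 / qFactorial q p.2)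

/-- The first leg `H^l E^n`. -/
def rLeft (q : ℂˣ) (p : ℕ × ℕ) : UqH q := UqH.H q ^ p.1 * UqH.E q ^ p.2

/-- The second leg `H^l F^n`. -/
def rRight (q : ℂˣ) (p : ℕ × ℕ) : UqH q := UqH.H q ^ p.1 * UqH.F q ^ p.2

/-- `∑ a₍₁₎ S(r₂) ⊗ (r₁ ▷ a₍₂₎)` for `a` in `U_q(sl_2)`. -/
def twistedComul (q : ℂˣ) (r₁ r₂ : UqH q) : Uq q →ₗ[ℂ] UqH q ⊗[ℂ] UqH q :=
  TensorProduct.map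
    (LinearMap.mulRight ℂ (UqH.antipode q r₂) ∘ₗ (UqH.ofUq q).toLinearMap)
    (UqH.ad q r₁ ∘ₗ (UqH.ofUq q).toLinearMap) ∘ₗ (Uq.comul q).toLinearMap

/-- The terms of the series `∑ a₍₁₎ S(R₂) ⊗ (R₁ ▷ a₍₂₎)`. -/
def braidedComulTerm (q : ℂˣ) (h : ℂ) (a : Uq q) (p : ℕ × ℕ) : Completion₂ :=
  toCompletion₂ q (rCoeff q h p • twistedComul q (rLeft q p) (rRight q p) a)

/-- The braided coproduct `∑ a₍₁₎ S(R₂) ⊗ (R₁ ▷ a₍₂₎)`. -/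
def braidedComul (q : ℂˣ) (h : ℂ) (a : Uq q) : Completion₂ :=
  ∑' p : ℕ × ℕ, braidedComulTerm q h a p

/-- The terms of the series `∑ R₂ S(R₁ ▷ a)`. -/
def braidedAntipodeTerm (q : ℂˣ) (h : ℂ) (a : Uq q) (p : ℕ × ℕ) : Completion :=
  toCompletion q
    (rCoeff q h p • (rRight q p * UqH.antipode q (UqH.ad q (rLeft q p) (UqH.ofUq q a))))

/-- The braided antipode `∑ R₂ S(R₁ ▷ a)`. -/
def braidedAntipode (q : ℂˣ) (h : ℂ) (a : Uq q) : Completion :=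
  ∑' p : ℕ × ℕ, braidedAntipodeTerm q h a p

end QuantumSL2

end

/-!
Both series become finite because of how the adjoint action treats the Casimir element. It kills
`Cas_q` (`ad_H_Cas`, `ad_E_Cas`), so only the leading term of `R` contributes to the braided
antipode, and what is left is `S(Cas_q) = Cas_q` (`antipode_Cas`).

For the braided coproduct, the right legs of the coproduct of `Cas_q` can be taken to be `K`, `KF`,
`E` and `Cas_q` (`map_comul_Cas`). Under the adjoint action these are weight vectors of weights
`0, -2, 2, 0`, and `E` acts by `KF ↦ α Cas_q + β K`, `K ↦ (1 - q²) E`, `E ↦ 0`, `Cas_q ↦ 0`. Hence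
only the powers `E^n` with `n ≤ 2` contribute. For a fixed `n`, the powers of `H` act on a right leg
of weight `2w` by scalars, so the sum over `l` is the exponential series of `-(ln q) w H` in the
left leg. Its sum is `K^{-w}`, because `K = q^H` on every `V_m` (`hasSum_exp_H`). This gives a closed
formula for each tensor `x ⊗ y` (`hasSum_twist`); adding up the four of them, the result is an
identity between finite sums in `U ⊗ U`, which the commutation relations decide.
-/

namespace QuantumSL2

noncomputable section

/-! ### Structure maps on generators -/

namespace Uq

variable (q : ℂˣ)

theorem lift_gen {A : Type} [Ring A] [Algebra ℂ A] (e f k k' : A) (h1 h2 h3 h4 h5) (g : Gen) :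
    lift q e f k k' h1 h2 h3 h4 h5 (gen q g) = (match g with
      | Gen.E => e | Gen.F => f | Gen.K => k | Gen.Kinv => k') :=
  (RingQuot.liftAlgHom_mkAlgHom_apply ℂ _ _ _).trans (FreeAlgebra.lift_ι_apply _ _)

@[simp] theorem comul_E : comul q (E q) = E q ⊗ₜ K q + 1 ⊗ₜ E q := by
  simp [comul, lift_gen]

@[simp] theorem comul_F : comul q (F q) = F q ⊗ₜ 1 + Kinv q ⊗ₜ F q := by
  simp [comul, lift_gen]

@[simp] theorem comul_K : comul q (K q) = K q ⊗ₜ K q := by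
  simp [comul, lift_gen]

@[simp] theorem comul_Kinv : comul q (Kinv q) = Kinv q ⊗ₜ Kinv q := by
  simp [comul, lift_gen]

end Uq

namespace UqH

variable (q : ℂˣ)

theorem lift_gen {A : Type} [Ring A] [Algebra ℂ A] (e f k k' h : A)
    (h1 h2 h3 h4 h5 h6 h7 h8) (g : GenH) :
    lift q e f k k' h h1 h2 h3 h4 h5 h6 h7 h8 (gen q g) = (match g with
      | GenH.E => e | GenH.F => f | GenH.K => k | GenH.Kinv => k' | GenH.H => h) :=
  (RingQuot.liftAlgHom_mkAlgHom_apply ℂ _ _ _).trans (FreeAlgebra.lift_ι_apply _ _)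

@[simp] theorem ofUq_E : ofUq q (Uq.E q) = E q := by simp [ofUq, Uq.lift_gen]

@[simp] theorem ofUq_F : ofUq q (Uq.F q) = F q := by simp [ofUq, Uq.lift_gen]

@[simp] theorem ofUq_K : ofUq q (Uq.K q) = K q := by simp [ofUq, Uq.lift_gen]

@[simp] theorem ofUq_Kinv : ofUq q (Uq.Kinv q) = Kinv q := by
  simp [ofUq, Uq.lift_gen]

@[simp] theorem comul_E : comul q (E q) = E q ⊗ₜ K q + 1 ⊗ₜ E q := by
  simp [comul, lift_gen]

@[simp] theorem comul_H : comul q (H q) = H q ⊗ₜ 1 + 1 ⊗ₜ H q := by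
  simp [comul, lift_gen]

@[simp] theorem antipode_one : antipode q 1 = 1 := by simp [antipode]

@[simp] theorem antipode_mul (x y : UqH q) :
    antipode q (x * y) = antipode q y * antipode q x := by simp [antipode]

@[simp] theorem antipode_pow (x : UqH q) (n : ℕ) : antipode q (x ^ n) = antipode q x ^ n := by
  simp [antipode]

@[simp] theorem antipode_E : antipode q (E q) = -(E q * Kinv q) := by
  simp [antipode, antipodeOp, lift_gen]

@[simp] theorem antipode_F : antipode q (F q) = -(K q * F q) := by
  simp [antipode, antipodeOp, lift_gen]

@[simp] theorem antipode_K : antipode q (K q) = Kinv q := by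
  simp [antipode, antipodeOp, lift_gen]

@[simp] theorem antipode_Kinv : antipode q (Kinv q) = K q := by
  simp [antipode, antipodeOp, lift_gen]

@[simp] theorem antipode_H : antipode q (H q) = -H q := by
  simp [antipode, antipodeOp, lift_gen]

/-! ### The adjoint action -/

/-- The algebra homomorphism `x ⊗ y ↦ (a ↦ x a S(y))` through which the adjoint action factors. -/
def sandwich : UqH q ⊗[ℂ] UqH q →ₐ[ℂ] Module.End ℂ (UqH q) :=
  Algebra.TensorProduct.lift (Algebra.lmul ℂ (UqH q))
    (AlgHom.ofLinearMap ((LinearMap.mul ℂ (UqH q)).flip ∘ₗ antipode q)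
      (by ext; simp) (by intro x y; ext; simp [mul_assoc]))
    (fun x y => by
      simp only [commute_iff_eq]
      ext a
      simp [mul_assoc])

theorem ad_eq_sandwich (x : UqH q) : ad q x = sandwich q (comul q x) := by
  have : ∀ t : UqH q ⊗[ℂ] UqH q, TensorProduct.lift
      ((LinearMap.mul ℂ (Module.End ℂ (UqH q))).compl₁₂ (LinearMap.mul ℂ (UqH q))
      ((LinearMap.mul ℂ (UqH q)).flip ∘ₗ antipode q)) t = sandwich q t := by
    intro t
    induction t with
    | zero => simp
    | tmul x y => ext a; simp [sandwich]
    | add s t hs ht => rw [map_add, map_add, hs, ht]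
  exact this _

@[simp] theorem ad_one (a : UqH q) : ad q 1 a = a := by simp [ad_eq_sandwich]

@[simp] theorem ad_mul (x y a : UqH q) : ad q (x * y) a = ad q x (ad q y a) := by
  simp [ad_eq_sandwich]

theorem ad_E (a : UqH q) : ad q (E q) a = (E q * a - a * E q) * Kinv q := by
  simp [ad_eq_sandwich, sandwich, add_mul, mul_assoc, sub_eq_add_neg]

theorem ad_H (a : UqH q) : ad q (H q) a = H q * a - a * H q := by
  simp [ad_eq_sandwich, sandwich, sub_eq_add_neg]

/-- The adjoint action of `E` raises the weight by `2`. -/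
theorem ad_H_ad_E_pow {y : UqH q} {w : ℤ} (hy : ad q (H q) y = (2 * w : ℂ) • y) (n : ℕ) :
    ad q (H q) (ad q (E q ^ n) y) = (2 * (w + n : ℤ) : ℂ) • ad q (E q ^ n) y := by
  induction n with
  | zero => simpa using hy
  | succ n ih =>
    have h : H q * E q = E q * H q + (2 : ℂ) • E q := by rw [← H_E]; abel
    rw [pow_succ', ad_mul, ← ad_mul, h, map_add, LinearMap.add_apply, ad_mul, ih, map_smul,
      map_smul, LinearMap.smul_apply, ← add_smul]
    push_cast
    ring_nf

theorem ad_H_pow {y : UqH q} {c : ℂ} (hy : ad q (H q) y = c • y) (l : ℕ) :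
    ad q (H q ^ l) y = c ^ l • y := by
  induction l with
  | zero => simp
  | succ l ih => rw [pow_succ, ad_mul, hy, map_smul, ih, smul_smul, pow_succ']

theorem ad_E_pow_eq_zero {y : UqH q} {N n : ℕ} (hy : ad q (E q ^ N) y = 0) (hn : N ≤ n) :
    ad q (E q ^ n) y = 0 := by
  obtain ⟨k, rfl⟩ := Nat.exists_eq_add_of_le' hn
  rw [pow_add, ad_mul, hy, map_zero]

/-- `K` as a unit, so that its integer powers make sense. -/
def KUnit : (UqH q)ˣ := ⟨K q, Kinv q, K_mul_Kinv q, Kinv_mul_K q⟩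

end UqH

/-! ### Summation in the completion -/

section Completion

open UqH

variable (q : ℂˣ)

@[simp] theorem rep_H (m : ℕ) : rep q m (H q) = matH m := by simp [rep, UqH.lift_gen]

@[simp] theorem rep_K (m : ℕ) : rep q m (K q) = matK q m := by simp [rep, UqH.lift_gen]

@[simp] theorem rep_Kinv (m : ℕ) : rep q m (Kinv q) = matKinv q m := by
  simp [rep, UqH.lift_gen]

/-- On `V_m` the power `K^z` acts as `q^(zH)`. -/
theorem rep_KUnit_zpow (m : ℕ) (z : ℤ) :
    rep q m ((KUnit q ^ z : (UqH q)ˣ) : UqH q)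
      = Matrix.diagonal fun j : Fin (m + 1) => (q : ℂ) ^ (z * ((m : ℤ) - 2 * (j : ℕ))) := by
  have hK : ((KUnit q : (UqH q)ˣ) : UqH q) = K q := rfl
  have hKinv : (((KUnit q)⁻¹ : (UqH q)ˣ) : UqH q) = Kinv q := rfl
  obtain ⟨n, rfl | rfl⟩ := z.eq_nat_or_neg
  · rw [zpow_natCast, Units.val_pow_eq_pow_val, map_pow, hK, rep_K, matK, Matrix.diagonal_pow]
    congr 1
    ext j
    rw [mul_comm, zpow_mul]
    simp
  · rw [zpow_neg, ← inv_zpow, zpow_natCast, Units.val_pow_eq_pow_val, map_pow, hKinv, rep_Kinv,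
      matKinv, Matrix.diagonal_pow]
    congr 1
    ext j
    rw [neg_mul, ← mul_neg, mul_comm, zpow_mul]
    simp

theorem toCompletion₂_tmul (x y : UqH q) (m n : ℕ) (i j : Fin (m + 1) × Fin (n + 1)) :
    toCompletion₂ q (x ⊗ₜ y) m n i j = rep q m x i.1 j.1 * rep q n y i.2 j.2 := by
  simp [toCompletion₂, Matrix.kroneckerBilinear, Matrix.kroneckerMap_apply]

theorem hasSum_completion₂ {ι : Type*} {f : ι → Completion₂} {g : Completion₂}
    (H : ∀ m n i j, HasSum (fun p => f p m n i j) (g m n i j)) : HasSum f g :=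
  Pi.hasSum.2 fun m => Pi.hasSum.2 fun n => Pi.hasSum.2 fun i => Pi.hasSum.2 fun j => H m n i j

/-- Since `K = q^H` on each `V_m`, a vector of weight `2w` in the right leg turns the exponential
factor of `R` into `K^{-w}` in the left leg. -/
theorem hasSum_exp_H {h : ℂ} (hh : Complex.exp h = q) (x y : UqH q) (w : ℤ) :
    HasSum (fun l : ℕ => toCompletion₂ q
        (((h / 2) ^ l / (l.factorial : ℂ)) • ((x * (-H q) ^ l) ⊗ₜ[ℂ] ((2 * w : ℂ) ^ l • y))))
      (toCompletion₂ q ((x * ((KUnit q ^ (-w) : (UqH q)ˣ) : UqH q)) ⊗ₜ y)) := by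
  refine hasSum_completion₂ fun m n i j => ?_
  set k : ℤ := (m : ℤ) - 2 * (j.1 : ℕ) with hk
  have hexp : (q : ℂ) ^ (-w * k) = NormedSpace.exp (h * (-w * k)) := by
    rw [← hh, ← Complex.exp_int_mul, ← Complex.exp_eq_exp_ℂ]
    congr 1
    push_cast
    ring
  have hs := ((NormedSpace.expSeries_div_hasSum_exp (h * (-w * k))).mul_left
    (rep q m x i.1 j.1 * rep q n y i.2 j.2))
  rw [toCompletion₂_tmul, map_mul, rep_KUnit_zpow, Matrix.mul_diagonal, ← hk, hexp,
    mul_right_comm]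
  refine hs.congr_fun fun l => ?_
  have hH : rep q m ((-H q) ^ l) = Matrix.diagonal fun j : Fin (m + 1) =>
      (-(((m : ℤ) - 2 * (j : ℕ) : ℤ) : ℂ)) ^ l := by
    rw [map_pow, map_neg, rep_H, matH, Matrix.diagonal_neg, Matrix.diagonal_pow]
    rfl
  rw [map_smul]
  simp only [Pi.smul_apply, Matrix.smul_apply]
  rw [toCompletion₂_tmul, map_mul, hH, Matrix.mul_diagonal, ← hk, map_smul, Matrix.smul_apply,
    smul_eq_mul, smul_eq_mul]
  have h2 : (h * (-w * k : ℂ)) ^ l = (h / 2) ^ l * (2 * w) ^ l * (-k) ^ l := by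
    rw [← mul_pow, ← mul_pow]
    congr 1
    ring
  rw [h2]
  ring

/-- The part of the coefficient of `R` that depends on the power of `E ⊗ F` only. -/
def nilCoeff (n : ℕ) : ℂ :=
  (q : ℂ) ^ (n * (n + 1) / 2) * (1 - ((q : ℂ) ^ 2)⁻¹) ^ n / qFactorial q n

/-- A double series with finitely many nonzero columns is summed column by column. -/
theorem hasSum_of_columns {A : Type*} [AddCommMonoid A] [TopologicalSpace A] [ContinuousAdd A]
    {f : ℕ × ℕ → A} {g : ℕ → A} {N : ℕ} (hf : ∀ n < N, HasSum (fun l => f (l, n)) (g n))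
    (h0 : ∀ l n, N ≤ n → f (l, n) = 0) : HasSum f (∑ n ∈ Finset.range N, g n) := by
  have hcol : ∀ n ∈ Finset.range N, HasSum (fun p : ℕ × ℕ => if p.2 = n then f p else 0) (g n) := by
    intro n hn
    have hinj : Function.Injective fun l : ℕ => (l, n) := fun a b hab => congrArg Prod.fst hab
    rw [← hinj.hasSum_iff]
    · simpa [Function.comp_def] using hf n (Finset.mem_range.1 hn)
    · rintro ⟨l, k⟩ hk
      rw [if_neg]
      rintro rfl
      exact hk ⟨l, rfl⟩
  refine (hasSum_sum hcol).congr_fun ?_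
  rintro ⟨l, n⟩
  by_cases hn : n < N
  · simp [hn]
  · simp [h0 l n (not_lt.1 hn)]

/-- The action of `R` on `x ⊗ y`, by the antipode and right multiplication on the left leg and by
the adjoint action on the right leg, when `y` is a weight vector killed by a power of `E`. -/
theorem hasSum_twist {h : ℂ} (hh : Complex.exp h = q) (x : UqH q) {y : UqH q} {w : ℤ} {N : ℕ}
    (hw : ad q (H q) y = (2 * w : ℂ) • y) (hN : ad q (E q ^ N) y = 0) :
    HasSum (fun p => toCompletion₂ q
        (rCoeff q h p • ((x * antipode q (rRight q p)) ⊗ₜ[ℂ] ad q (rLeft q p) y)))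
      (toCompletion₂ q (∑ n ∈ Finset.range N, nilCoeff q n •
        ((x * antipode q (F q) ^ n * ((KUnit q ^ (-(w + n)) : (UqH q)ˣ) : UqH q))
          ⊗ₜ[ℂ] ad q (E q ^ n) y))) := by
  rw [map_sum]
  refine hasSum_of_columns (fun n _ => ?_) (fun l n hn => ?_)
  · have hs := (hasSum_exp_H q hh (x * antipode q (F q) ^ n) (ad q (E q ^ n) y) (w + n)).const_smul
      (nilCoeff q n)
    rw [← map_smul] at hs
    refine hs.congr_fun fun l => ?_
    rw [← map_smul, smul_smul, rRight, rLeft, ad_mul, ad_H_pow q (ad_H_ad_E_pow q hw n),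
      antipode_mul, antipode_pow, antipode_pow, antipode_H, ← mul_assoc, rCoeff, mul_comm]
    rfl
  · simp [rLeft, ad_E_pow_eq_zero q hN hn]

end Completion

/-! ### Commutation rules and the Casimir element -/

namespace UqH

variable (q : ℂˣ)

theorem E_mul_Kinv : E q * Kinv q = (q : ℂ) ^ 2 • (Kinv q * E q) :=
  kinv_mul_e q (K_mul_Kinv q) (Kinv_mul_K q) (K_mul_E q)

theorem F_mul_Kinv : F q * Kinv q = ((q : ℂ) ^ 2)⁻¹ • (Kinv q * F q) :=
  kinv_mul_f q (K_mul_Kinv q) (Kinv_mul_K q) (K_mul_F q)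

theorem E_mul_K : E q * K q = ((q : ℂ) ^ 2)⁻¹ • (K q * E q) := by
  rw [K_mul_E, smul_smul, inv_mul_cancel₀ (pow_ne_zero _ q.ne_zero), one_smul]

theorem F_mul_K : F q * K q = (q : ℂ) ^ 2 • (K q * F q) := by
  rw [K_mul_F, smul_smul, mul_inv_cancel₀ (pow_ne_zero _ q.ne_zero), one_smul]

theorem F_mul_E :
    F q * E q = E q * F q - ((q : ℂ) - (q : ℂ)⁻¹)⁻¹ • (K q - Kinv q) := by
  rw [← E_F]; abel

theorem K_mul_Kinv_mul (x : UqH q) : K q * (Kinv q * x) = x := by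
  rw [← mul_assoc, K_mul_Kinv, one_mul]

theorem Kinv_mul_K_mul (x : UqH q) : Kinv q * (K q * x) = x := by
  rw [← mul_assoc, Kinv_mul_K, one_mul]

theorem E_mul_Kinv_mul (x : UqH q) :
    E q * (Kinv q * x) = (q : ℂ) ^ 2 • (Kinv q * (E q * x)) := by
  rw [← mul_assoc, E_mul_Kinv, smul_mul_assoc, mul_assoc]

theorem F_mul_Kinv_mul (x : UqH q) :
    F q * (Kinv q * x) = ((q : ℂ) ^ 2)⁻¹ • (Kinv q * (F q * x)) := by
  rw [← mul_assoc, F_mul_Kinv, smul_mul_assoc, mul_assoc]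

theorem E_mul_K_mul (x : UqH q) : E q * (K q * x) = ((q : ℂ) ^ 2)⁻¹ • (K q * (E q * x)) := by
  rw [← mul_assoc, E_mul_K, smul_mul_assoc, mul_assoc]

theorem F_mul_K_mul (x : UqH q) : F q * (K q * x) = (q : ℂ) ^ 2 • (K q * (F q * x)) := by
  rw [← mul_assoc, F_mul_K, smul_mul_assoc, mul_assoc]

theorem H_mul_E : H q * E q = E q * H q + (2 : ℂ) • E q := by rw [← H_E]; abel

theorem H_mul_F : H q * F q = F q * H q - (2 : ℂ) • F q := by
  rw [sub_eq_add_neg, ← neg_smul, ← H_F]; abel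

/-- The Casimir element, in the algebra with `H` adjoined. -/
def Cas : UqH q := ofUq q (Uq.Cas q)

theorem Cas_eq : Cas q =
    E q * F q + (((q : ℂ) - (q : ℂ)⁻¹) ^ 2)⁻¹ • ((q : ℂ) • Kinv q + (q : ℂ)⁻¹ • K q) := by
  simp [Cas, Uq.Cas]

theorem ad_H_Cas : ad q (H q) (Cas q) = 0 := by
  have h : H q * (E q * F q) = E q * F q * H q := by
    rw [← mul_assoc, H_mul_E, add_mul, mul_assoc, H_mul_F, mul_sub, mul_smul_comm, smul_mul_assoc,
      mul_assoc]
    abel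
  simp only [ad_H, Cas_eq, mul_add, add_mul, h, mul_smul_comm, smul_mul_assoc, H_K, H_Kinv,
    sub_self]

theorem ad_H_K : ad q (H q) (K q) = 0 := by rw [ad_H, H_K, sub_self]

theorem ad_H_E : ad q (H q) (E q) = (2 : ℂ) • E q := by rw [ad_H, H_E]

theorem ad_H_K_mul_F : ad q (H q) (K q * F q) = (-2 : ℂ) • (K q * F q) := by
  rw [ad_H, ← mul_assoc, H_K, mul_assoc, mul_assoc, ← mul_sub, H_F, mul_smul_comm]

theorem ad_E_E : ad q (E q) (E q) = 0 := by rw [ad_E, sub_self, zero_mul]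

theorem ad_E_K : ad q (E q) (K q) = (1 - (q : ℂ) ^ 2) • E q := by
  rw [ad_E, K_mul_E, sub_mul, smul_mul_assoc, mul_assoc, K_mul_Kinv, mul_one, sub_smul, one_smul]

variable {q}

theorem sq_sub_one_ne_zero (hq : ∀ n : ℕ, 0 < n → q ^ n ≠ 1) : (q : ℂ) ^ 2 - 1 ≠ 0 := fun e =>
  hq 2 two_pos (Units.ext (by simpa using sub_eq_zero.1 e))

/-- Displays the denominator of `q - q⁻¹`, so that `field_simp` can see that it is nonzero. -/
theorem sub_inv_eq : (q : ℂ) - (q : ℂ)⁻¹ = ((q : ℂ) ^ 2 - 1) / q := by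
  have hz := q.ne_zero
  field_simp

theorem ad_E_Cas (hd : (q : ℂ) ^ 2 - 1 ≠ 0) : ad q (E q) (Cas q) = 0 := by
  have hz := q.ne_zero
  rw [ad_E, sub_eq_zero.2, zero_mul]
  simp only [Cas_eq, sub_inv_eq, mul_add, add_mul, mul_smul_comm, smul_mul_assoc, mul_assoc,
    F_mul_E, mul_sub, E_mul_K, E_mul_Kinv]
  match_scalars <;> field_simp <;> ring

/-- The elements `KF`, `K`, `E` and the invariant `Cas_q` span a submodule of the adjoint action. -/
theorem ad_E_K_mul_F (hd : (q : ℂ) ^ 2 - 1 ≠ 0) : ad q (E q) (K q * F q) =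
    (((q : ℂ) ^ 2)⁻¹ - 1) • Cas q
      + ((q : ℂ)⁻¹ * ((q : ℂ) + (q : ℂ)⁻¹) * ((q : ℂ) - (q : ℂ)⁻¹)⁻¹) • K q := by
  have hz := q.ne_zero
  simp only [ad_E, Cas_eq, sub_inv_eq, mul_add, add_mul, mul_smul_comm, smul_mul_assoc,
    mul_assoc, F_mul_E, mul_sub, sub_mul, smul_sub, smul_add, F_mul_Kinv, E_mul_K_mul,
    E_mul_Kinv_mul, K_mul_Kinv, K_mul_Kinv_mul, mul_one, one_mul]
  match_scalars <;> field_simp <;> ring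

theorem antipode_Cas (hd : (q : ℂ) ^ 2 - 1 ≠ 0) : antipode q (Cas q) = Cas q := by
  have hz := q.ne_zero
  simp only [Cas_eq, sub_inv_eq, map_add, map_smul, antipode_mul, antipode_E, antipode_F,
    antipode_K, antipode_Kinv, neg_mul, mul_neg, mul_assoc, E_mul_Kinv, F_mul_Kinv_mul, F_mul_E,
    mul_smul_comm, K_mul_Kinv_mul]
  match_scalars <;> field_simp <;> ring

/-- The coproduct of the Casimir element, written so that its right legs are the weight vectors
`K, KF, E` and the invariant element `Cas_q` of the adjoint action. -/
theorem map_comul_Cas (hd : (q : ℂ) ^ 2 - 1 ≠ 0) :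
    TensorProduct.map (ofUq q).toLinearMap (ofUq q).toLinearMap (Uq.comul q (Uq.Cas q)) =
      (E q * F q + ((q : ℂ)⁻¹ * (((q : ℂ) - (q : ℂ)⁻¹) ^ 2)⁻¹) • (K q - Kinv q)) ⊗ₜ K q
        + (E q * Kinv q) ⊗ₜ (K q * F q) + F q ⊗ₜ E q + Kinv q ⊗ₜ Cas q := by
  have hz := q.ne_zero
  simp only [Cas_eq, Uq.Cas, sub_inv_eq, map_add, map_smul, map_mul, Uq.comul_E, Uq.comul_F,
    Uq.comul_K, Uq.comul_Kinv, mul_add, add_mul, Algebra.TensorProduct.tmul_mul_tmul, mul_one,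
    one_mul, TensorProduct.map_tmul, AlgHom.toLinearMap_apply, ofUq_E, ofUq_F, ofUq_K, ofUq_Kinv,
    TensorProduct.tmul_add, TensorProduct.add_tmul, TensorProduct.tmul_smul,
    ← TensorProduct.smul_tmul', TensorProduct.sub_tmul, smul_add, smul_sub]
  match_scalars <;> field_simp
  ring

end UqH

/-! ### The braided coproduct and the braided antipode of the Casimir element -/

section

open UqH

variable {q : ℂˣ}

theorem twistedComul_apply (r₁ r₂ : UqH q) (a : Uq q) :
    twistedComul q r₁ r₂ a = TensorProduct.map (LinearMap.mulRight ℂ (antipode q r₂)) (ad q r₁)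
      (TensorProduct.map (ofUq q).toLinearMap (ofUq q).toLinearMap (Uq.comul q a)) := by
  rw [twistedComul, TensorProduct.map_comp]
  rfl

theorem qFactorial_one (hd : (q : ℂ) ^ 2 - 1 ≠ 0) : qFactorial q 1 = 1 := by
  have hz := q.ne_zero
  have hd' : (q : ℂ) - (q : ℂ)⁻¹ ≠ 0 := by
    rw [sub_inv_eq]
    exact div_ne_zero hd hz
  simp [qFactorial, qNumber, hd']

theorem qFactorial_two (hd : (q : ℂ) ^ 2 - 1 ≠ 0) : qFactorial q 2 = (q : ℂ) + (q : ℂ)⁻¹ := by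
  have hz := q.ne_zero
  rw [qFactorial, Finset.prod_range_succ, ← qFactorial, qFactorial_one hd, one_mul, qNumber]
  norm_num
  norm_cast
  simp only [Units.val_pow_eq_pow_val, Units.val_inv_eq_inv_val]
  field_simp
  ring

theorem nilCoeff_zero : nilCoeff q 0 = 1 := by simp [nilCoeff, qFactorial]

theorem nilCoeff_one (hd : (q : ℂ) ^ 2 - 1 ≠ 0) : nilCoeff q 1 = (q : ℂ) - (q : ℂ)⁻¹ := by
  have hz := q.ne_zero
  simp [nilCoeff, qFactorial_one hd]
  field_simp

theorem nilCoeff_two (hd : (q : ℂ) ^ 2 - 1 ≠ 0) :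
    nilCoeff q 2 = (q : ℂ) * ((q : ℂ) - (q : ℂ)⁻¹) ^ 2 / ((q : ℂ) + (q : ℂ)⁻¹) := by
  have hz := q.ne_zero
  simp [nilCoeff, qFactorial_two hd]
  field_simp

theorem KUnit_val : ((KUnit q : (UqH q)ˣ) : UqH q) = K q := rfl

theorem KUnit_inv_val : (((KUnit q)⁻¹ : (UqH q)ˣ) : UqH q) = Kinv q := rfl

theorem hasSum_braidedComulTerm_Cas (hq : ∀ n : ℕ, 0 < n → q ^ n ≠ 1) {h : ℂ}
    (hh : Complex.exp h = q) :
    HasSum (braidedComulTerm q h (Uq.Cas q)) (toCompletion₂ q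
      (E q ⊗ₜ[ℂ] (K q * F q) + ((q : ℂ) ^ 2)⁻¹ • ((K q * F q) ⊗ₜ[ℂ] E q)
          + ((q : ℂ)⁻¹ * ((q : ℂ) - (q : ℂ)⁻¹) ^ 2) • (Cas q ⊗ₜ[ℂ] Cas q)
          - ((q : ℂ) ^ 2)⁻¹ • (Cas q ⊗ₜ[ℂ] K q) - ((q : ℂ) ^ 2)⁻¹ • (K q ⊗ₜ[ℂ] Cas q)
          + (((q : ℂ) ^ 2)⁻¹ * (((q : ℂ) + (q : ℂ)⁻¹) / ((q : ℂ) - (q : ℂ)⁻¹) ^ 2)) •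
              (K q ⊗ₜ[ℂ] K q))) := by
  have hz := q.ne_zero
  have hd := sq_sub_one_ne_zero hq
  -- `[2]_q! = q + q⁻¹` divides the coefficient of `E² ⊗ F²`.
  have hs : (q : ℂ) ^ 2 + 1 ≠ 0 := fun e => hq 4 four_pos (Units.ext (by
    push_cast
    linear_combination ((q : ℂ) ^ 2 - 1) * e))
  have hE1 : ad q (E q ^ 1) (E q) = 0 := by rw [pow_one, ad_E_E]
  have hK2 : ad q (E q ^ 2) (K q) = 0 := by
    rw [pow_two, ad_mul, ad_E_K, map_smul, ad_E_E, smul_zero]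
  have hC1 : ad q (E q ^ 1) (Cas q) = 0 := by rw [pow_one, ad_E_Cas hd]
  have hF2 : ad q (E q ^ 2) (K q * F q) = ((q : ℂ)⁻¹ * ((q : ℂ) + (q : ℂ)⁻¹)
      * ((q : ℂ) - (q : ℂ)⁻¹)⁻¹ * (1 - (q : ℂ) ^ 2)) • E q := by
    rw [pow_two, ad_mul, ad_E_K_mul_F hd, map_add, map_smul, map_smul, ad_E_Cas hd, smul_zero,
      zero_add, ad_E_K, smul_smul]
  have hF3 : ad q (E q ^ 3) (K q * F q) = 0 := by
    rw [pow_succ', ad_mul, hF2, map_smul, ad_E_E, smul_zero]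
  -- One series for each of the four tensors in the coproduct.
  have s1 := hasSum_twist q hh
    (E q * F q + ((q : ℂ)⁻¹ * (((q : ℂ) - (q : ℂ)⁻¹) ^ 2)⁻¹) • (K q - Kinv q)) (y := K q)
    (w := 0) (by simpa using ad_H_K q) hK2
  have s2 := hasSum_twist q hh (E q * Kinv q) (y := K q * F q)
    (w := -1) (by simpa using ad_H_K_mul_F q) hF3
  have s3 := hasSum_twist q hh (F q) (y := E q) (w := 1) (by simpa using ad_H_E q) hE1
  have s4 := hasSum_twist q hh (Kinv q) (y := Cas q) (w := 0) (by simpa using ad_H_Cas q) hC1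
  have s := ((s1.add s2).add s3).add s4
  rw [← map_add, ← map_add, ← map_add] at s
  have hterm : ∀ p, braidedComulTerm q h (Uq.Cas q) p = _ := fun p => by
    rw [braidedComulTerm, twistedComul_apply, map_comul_Cas hd, map_add, map_add, map_add,
      TensorProduct.map_tmul, TensorProduct.map_tmul, TensorProduct.map_tmul,
      TensorProduct.map_tmul, smul_add, smul_add, smul_add, map_add, map_add, map_add]
  have hsum := s.congr_fun hterm
  convert hsum using 2
  clear hsum hterm s s1 s2 s3 s4 hF3 hC1 hK2 hE1
  simp only [Finset.sum_range_succ, Finset.sum_range_zero, zero_add, nilCoeff_zero,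
    nilCoeff_one hd, nilCoeff_two hd, Nat.cast_zero, Nat.cast_one, Nat.cast_two, add_zero,
    neg_add_cancel, pow_zero, pow_one, ad_one, hF2, ad_E_K, ad_E_K_mul_F hd,
    antipode_F, zpow_zero, zpow_one, zpow_neg, inv_one, inv_inv, Units.val_one, mul_one,
    one_smul, KUnit_val, KUnit_inv_val, show (-1 + 2 : ℤ) = 1 from rfl]
  -- Both sides are expanded into tensors of monomials with the powers of `K` moved to the left.
  simp only [Cas_eq, pow_two (-(K q * F q)), sub_inv_eq, neg_mul, mul_neg, neg_neg, add_mul,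
    mul_add, sub_mul, mul_sub, smul_mul_assoc, mul_smul_comm, mul_assoc, E_mul_K, E_mul_Kinv,
    F_mul_Kinv, E_mul_K_mul, F_mul_K_mul, E_mul_Kinv_mul, F_mul_Kinv_mul, K_mul_Kinv_mul,
    Kinv_mul_K_mul, mul_one, TensorProduct.tmul_add, TensorProduct.add_tmul,
    TensorProduct.tmul_smul, ← TensorProduct.smul_tmul', TensorProduct.sub_tmul,
    TensorProduct.neg_tmul]
  match_scalars <;> field_simp <;> ring

/-- As `Cas_q` is invariant under the adjoint action, only the leading term of `R` contributes. -/
theorem braidedAntipodeTerm_Cas (hd : (q : ℂ) ^ 2 - 1 ≠ 0) (h : ℂ) (p : ℕ × ℕ) (hp : p ≠ (0, 0)) :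
    braidedAntipodeTerm q h (Uq.Cas q) p = 0 := by
  obtain ⟨l, n⟩ := p
  have hE : ad q (E q) (Cas q) = 0 := ad_E_Cas hd
  have h0 : ad q (rLeft q (l, n)) (Cas q) = 0 := by
    rw [rLeft, ad_mul]
    rcases n with - | n
    · rcases l with - | l
      · exact absurd rfl hp
      · rw [pow_zero, ad_one, pow_succ, ad_mul, ad_H_Cas, map_zero]
    · rw [pow_succ, ad_mul, hE, map_zero, map_zero]
  rw [braidedAntipodeTerm, ← Cas, h0, map_zero, mul_zero, smul_zero, map_zero]

theorem hasSum_braidedAntipodeTerm_Cas (hd : (q : ℂ) ^ 2 - 1 ≠ 0) (h : ℂ) :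
    HasSum (braidedAntipodeTerm q h (Uq.Cas q)) (toCompletion q (Cas q)) := by
  convert hasSum_single (0, 0) (braidedAntipodeTerm_Cas hd h) using 1
  rw [braidedAntipodeTerm, ← Cas]
  simp [rCoeff, rLeft, rRight, qFactorial, antipode_Cas hd]

end

end

end QuantumSL2

open QuantumSL2 QuantumSL2.Uq in
theorem lemma4p3 (q : ℂˣ) (hq : ∀ n : ℕ, 0 < n → q ^ n ≠ 1) (h : ℂ) (hh : Complex.exp h = q) :
    (Summable (braidedComulTerm q h (Cas q)) ∧
      braidedComul q h (Cas q) = embed₂ q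
        (E q ⊗ₜ[ℂ] (K q * F q) + ((q : ℂ) ^ 2)⁻¹ • ((K q * F q) ⊗ₜ[ℂ] E q)
          + ((q : ℂ)⁻¹ * ((q : ℂ) - (q : ℂ)⁻¹) ^ 2) • (Cas q ⊗ₜ[ℂ] Cas q)
          - ((q : ℂ) ^ 2)⁻¹ • (Cas q ⊗ₜ[ℂ] K q) - ((q : ℂ) ^ 2)⁻¹ • (K q ⊗ₜ[ℂ] Cas q)
          + (((q : ℂ) ^ 2)⁻¹ * (((q : ℂ) + (q : ℂ)⁻¹) / ((q : ℂ) - (q : ℂ)⁻¹) ^ 2)) •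
              (K q ⊗ₜ[ℂ] K q))) ∧
    (Summable (braidedAntipodeTerm q h (Cas q)) ∧
      braidedAntipode q h (Cas q) = embed q (Cas q)) := by
  have s := hasSum_braidedComulTerm_Cas hq hh
  have t := hasSum_braidedAntipodeTerm_Cas (UqH.sq_sub_one_ne_zero hq) h
  refine ⟨⟨s.summable, s.tsum_eq.trans ?_⟩, t.summable, t.tsum_eq⟩
  simp only [embed₂, LinearMap.comp_apply, map_add, map_sub, map_smul, TensorProduct.map_tmul,
    AlgHom.toLinearMap_apply, map_mul, UqH.ofUq_E, UqH.ofUq_F, UqH.ofUq_K, UqH.Cas]
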